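/- All groups are finite. For a finite group $H$, $\operatorname{rank}(H)$ is the minimum size of a generating set of $H$ (so the trivial group has rank $0$). For a generating set $A$ of $H$ and $g\in H$, let $l_A(g)$ be the minimum length of a (possibly empty) sequence of elements of $A$, inverses not being allowed as letters, whose product is $g$, and let $\operatorname{diam}(H,A)=\max\{l_A(g): g\in H\}$. We write $H^m$ for the $m$-th direct power of $H$. We say that $H$ satisfies the weak conjecture if for every natural number $m$ there is a generating set $A$ of $H^m$ of minimum size, that is, with $|A|=\operatorname{rank}(H^m)$, such that $$\operatorname{diam}(H^m,A)\le m\,\bigl(|H|-\operatorname{rank}(H)\bigr).$$ **Proposition.** Let $G$ be a finite solvable group with commutator subgroup $G'$, and let $\alpha=\operatorname{rank}(G)$ and $\beta=\operatorname{rank}(G/G')$. Then for every natural number $n\ge\alpha/\beta$ the group $H=G^n$ satisfies the weak conjecture; that is, for every natural number $m$ there is a generating set $A$ of $(G^n)^m$ of minimum size with $$\operatorname{diam}\bigl((G^n)^m,A\bigr)\le m\,\bigl(|G|^n-\operatorname{rank}(G^n)\bigr).$$ (If $G$ is trivial, then $\alpha=\beta=0$ and the condition $n\ge\alpha/\beta$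 is read as satisfied by every $n$; if $G$ is non-trivial, then $\beta\ge 1$.) -/

import Mathlib

/-- The length `l_A(g)` of `g` with respect to a generating set `A`: the minimum length of a
(possibly empty) sequence of elements of `A` whose product is `g`.  Inverses of elements of `A`
are not allowed as letters. -/
noncomputable def wordLength {G : Type*} [Group G] (A : Set G) (g : G) : ℕ :=
  sInf {k : ℕ | ∃ l : List G, l.length = k ∧ (∀ x ∈ l, x ∈ A) ∧ l.prod = g}

/-- The (directed) diameter of a finite group `G` with respect to a generating set `A`:
the maximum of `wordLength A g` over all `g` in `G`. -/
noncomputable def groupDiam (G : Type*) [Group G] [Finite G] (A : Set G) : ℕ :=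
  sSup (Set.range (wordLength A))

/-- `A` is a generating set of `G` of minimum size, i.e. of size `rank G`. -/
def IsMinSizeGeneratingSet (G : Type*) [Group G] [Finite G] (A : Set G) : Prop :=
  Subgroup.closure A = ⊤ ∧ A.ncard = Group.rank G

/-- The finite group `H` satisfies the weak conjecture: every direct power `H ^ m` has a
generating set `A` of minimum size with `diam (H ^ m, A) ≤ m (|H| - rank H)`. -/
def SatisfiesWeakConjecture (H : Type*) [Group H] [Finite H] : Prop :=
  ∀ m : ℕ, ∃ A : Set (Fin m → H), IsMinSizeGeneratingSet (Fin m → H) A ∧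
    (groupDiam (Fin m → H) A : ℤ) ≤ (m : ℤ) * ((Nat.card H : ℤ) - (Group.rank H : ℤ))

/-! ### Gaschütz's lemma: lifting generating tuples -/

namespace Group

/-! The heart of the matter is that rank is additive on powers of `H = G ^ n`. Write β for the rank
of `G / G'`. If `G` is solvable, then `G ^ k` is generated by `d` elements as soon as `rank G ≤ d`
and `k * β ≤ d` (`rank_pi_le`): generators of the abelianized power lift, factor by factor, to
generating tuples (Gaschütz), and a subdirect subgroup that covers the abelianization is everything.
Conversely `G ^ k` needs at least `k * β` generators, because `G / G'` maps onto an elementary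
abelian `p`-group of rank β (`mul_rank_abelianization_le_rank_pi`). Since `rank G ≤ n * β`, this
gives `m * rank H ≤ m * n * β ≤ rank (H ^ m)`.

Hence copies of a minimum generating set `B` of `H` in the `m` coordinates form a minimum generating
set of `H ^ m`. Spelling an element coordinate by coordinate costs at most `m * diam (H, B)`, and
`diam (H, B) ≤ |H| - |B|` because every length up to the diameter is attained. -/

theorem exists_closure_range_eq_top_of_rank_le {G : Type*} [Group G] [Group.FG G] {d : ℕ}
    (h : Group.rank G ≤ d) : ∃ t : Fin d → G, Subgroup.closure (Set.range t) = ⊤ := by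
  obtain ⟨S, hS, hc⟩ := Group.rank_spec G
  let e : Fin S.card ≃ S := S.equivFin.symm
  refine ⟨fun i => if hi : (i : ℕ) < S.card then e ⟨i, hi⟩ else 1, ?_⟩
  rw [eq_top_iff, ← hc, Subgroup.closure_le]
  intro x hx
  apply Subgroup.subset_closure
  refine ⟨⟨e.symm ⟨x, hx⟩, (e.symm ⟨x, hx⟩).2.trans_le (hS.trans_le h)⟩, ?_⟩
  simp

theorem rank_le_of_closure_range_eq_top {G : Type*} [Group G] [Group.FG G] {d : ℕ}
    (t : Fin d → G) (h : Subgroup.closure (Set.range t) = ⊤) : Group.rank G ≤ d := by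
  classical
  have := Group.rank_le (S := Finset.univ.image t) (by simpa using h)
  exact this.trans (Finset.card_image_le.trans (by simp))

/-- The number of lifts of `t` generating exactly `K` does not depend on `t`. -/
theorem card_lifts_closure_eq {G Q ι : Type*} [Group G] [Group Q] [Finite G] [Finite ι]
    (φ : G →* Q) {t t' : ι → Q} (ht : Subgroup.closure (Set.range t) = ⊤)
    (ht' : Subgroup.closure (Set.range t') = ⊤) (K : Subgroup G) :
    Nat.card {u : ι → G // φ ∘ u = t ∧ Subgroup.closure (Set.range u) = K} =
      Nat.card {u : ι → G // φ ∘ u = t' ∧ Subgroup.closure (Set.range u) = K} := by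
  classical
  induction K using WellFoundedLT.induction with
  | _ K ih =>
  -- If `K` does not map onto `Q`, no lift of a generating tuple can generate `K`, so both counts
  -- are zero.
  by_cases hK : K.map φ = ⊤
  swap
  · have key : ∀ s : ι → Q, Subgroup.closure (Set.range s) = ⊤ →
        IsEmpty {u : ι → G // φ ∘ u = s ∧ Subgroup.closure (Set.range u) = K} := by
      refine fun s hs => ⟨fun ⟨u, hu, hu'⟩ => hK ?_⟩
      rw [← hu', MonoidHom.map_closure, ← Set.range_comp, hu, hs]
    have := key t ht
    have := key t' ht'
    simp
  -- Lifts with entries in `K` are sorted by the subgroup they generate; the proper subgroups are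
  -- handled by induction.
  have split : ∀ s : ι → Q,
      Nat.card {u : ι → G // φ ∘ u = s ∧ ∀ i, u i ∈ K} =
        Nat.card {u : ι → G // φ ∘ u = s ∧ Subgroup.closure (Set.range u) = K} +
        Nat.card (Σ L : {L : Subgroup G // L < K},
          {u : ι → G // φ ∘ u = s ∧ Subgroup.closure (Set.range u) = L}) := by
    intro s
    rw [← Nat.card_sum]
    refine Nat.card_congr ⟨fun u => if h : Subgroup.closure (Set.range u.1) = K
      then Sum.inl ⟨u.1, u.2.1, h⟩
      else Sum.inr ⟨⟨Subgroup.closure (Set.range u.1), lt_of_le_of_ne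
        ((Subgroup.closure_le _).2 (by rintro _ ⟨i, rfl⟩; exact u.2.2 i)) h⟩, u.1, u.2.1, rfl⟩,
      Sum.elim (fun u => ⟨u.1, u.2.1, fun i => ?_⟩) (fun u => ⟨u.2.1, u.2.2.1, fun i => ?_⟩),
      ?_, ?_⟩
    · exact u.2.2.le (Subgroup.subset_closure ⟨i, rfl⟩)
    · exact u.1.2.le (u.2.2.2.le (Subgroup.subset_closure ⟨i, rfl⟩))
    · intro u
      by_cases h : Subgroup.closure (Set.range u.1) = K <;> simp [h]
    · rintro (⟨u, hu, hu'⟩ | ⟨⟨L, hL⟩, u, hu, hu'⟩)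
      · simp [hu']
      · dsimp only at hu'
        subst hu'
        simp [hL.ne]
  -- Since `K` covers `Q`, translation by a tuple in `K` lying over `t' * t⁻¹` matches the two sets
  -- of lifts.
  have total : Nat.card {u : ι → G // φ ∘ u = t ∧ ∀ i, u i ∈ K} =
      Nat.card {u : ι → G // φ ∘ u = t' ∧ ∀ i, u i ∈ K} := by
    have hc : ∀ i, ∃ c ∈ K, φ c = t' i * (t i)⁻¹ := fun i => by
      have : t' i * (t i)⁻¹ ∈ K.map φ := hK ▸ Subgroup.mem_top _
      simpa using this
    choose c hcK hc using hc
    refine Nat.card_congr ((Equiv.mulLeft c).subtypeEquiv fun u => ?_)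
    refine and_congr ?_ (forall_congr' fun i => ?_)
    · rw [funext_iff, funext_iff]
      refine forall_congr' fun i => ?_
      simp [hc, mul_assoc, mul_eq_left, inv_mul_eq_one, eq_comm (a := t i)]
    · simp [K.mul_mem_cancel_left (hcK i)]
  have hsum : Nat.card (Σ L : {L : Subgroup G // L < K},
          {u : ι → G // φ ∘ u = t ∧ Subgroup.closure (Set.range u) = L}) =
      Nat.card (Σ L : {L : Subgroup G // L < K},
          {u : ι → G // φ ∘ u = t' ∧ Subgroup.closure (Set.range u) = L}) := by
    have := Fintype.ofFinite {L : Subgroup G // L < K}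
    rw [Nat.card_sigma, Nat.card_sigma]
    exact Finset.sum_congr rfl fun L _ => ih L.1 L.2
  rw [split, split, hsum] at total
  exact Nat.add_right_cancel total

/-- **Gaschütz's lemma**. -/
theorem exists_lift_closure_range_eq_top {G Q : Type*} [Group G] [Group Q] [Finite G]
    (φ : G →* Q) (hφ : Function.Surjective φ) {d : ℕ} (hd : Group.rank G ≤ d)
    (t : Fin d → Q) (ht : Subgroup.closure (Set.range t) = ⊤) :
    ∃ u : Fin d → G, φ ∘ u = t ∧ Subgroup.closure (Set.range u) = ⊤ := by
  obtain ⟨s, hs⟩ := exists_closure_range_eq_top_of_rank_le hd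
  have hs' : Subgroup.closure (Set.range (φ ∘ s)) = ⊤ := by
    rw [Set.range_comp, ← MonoidHom.map_closure, hs, Subgroup.map_top_of_surjective φ hφ]
  -- The image of a generating tuple of `G` has a generating lift, so the count is positive there,
  -- hence also for `t`.
  have h := card_lifts_closure_eq φ hs' ht ⊤
  have : Nonempty {u : Fin d → G // φ ∘ u = φ ∘ s ∧ Subgroup.closure (Set.range u) = ⊤} :=
    ⟨s, rfl, hs⟩
  have hpos := h ▸ Nat.card_pos (α := {u : Fin d → G //
    φ ∘ u = φ ∘ s ∧ Subgroup.closure (Set.range u) = ⊤})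
  obtain ⟨u, hu⟩ := (Nat.card_pos_iff.1 hpos).1
  exact ⟨u, hu⟩

end Group

/-! ### Upper bound for the rank of powers of a solvable group -/

namespace Group

/-- The quotient by `M` is both perfect and solvable, hence trivial. -/
theorem eq_top_of_sup_commutator_eq_top {X : Type*} [Group X] [Group.IsSolvable X]
    (M : Subgroup X) [M.Normal] (h : M ⊔ commutator X = ⊤) : M = ⊤ := by
  have hperf : commutator (X ⧸ M) = ⊤ := by
    have hs := QuotientGroup.mk'_surjective M
    rw [commutator_def, ← Subgroup.map_top_of_surjective _ hs, ← Subgroup.map_commutator,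
      ← commutator_def, ← h, Subgroup.map_sup, QuotientGroup.map_mk'_self, bot_sup_eq]
  have hsub : Subsingleton (X ⧸ M) := by
    by_contra hn
    rw [not_subsingleton_iff_nontrivial] at hn
    have : Group.IsSolvable (X ⧸ M) :=
      Group.isSolvable_of_surjective (QuotientGroup.mk'_surjective M)
    exact (Group.IsSolvable.commutator_lt_top_of_nontrivial (X ⧸ M)).ne hperf
  exact QuotientGroup.subgroup_eq_top_of_subsingleton M hsub

/-- A subdirect subgroup of `X × Y`, with `X` solvable, that covers the abelianization of `X × Y`
is everything. -/
theorem eq_top_of_subdirect {X Y : Type*} [Group X] [Group Y] [Group.IsSolvable X]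
    (S : Subgroup (X × Y)) (hX : S.map (MonoidHom.fst X Y) = ⊤)
    (hY : S.map (MonoidHom.snd X Y) = ⊤)
    (h : ∀ x y, ∃ s ∈ S, s.1⁻¹ * x ∈ commutator X ∧ s.2⁻¹ * y ∈ commutator Y) : S = ⊤ := by
  have hX' : ∀ x, ∃ y, (x, y) ∈ S := fun x => by
    have : x ∈ S.map (MonoidHom.fst X Y) := hX ▸ Subgroup.mem_top x
    simpa using this
  have hY' : ∀ y, ∃ x, (x, y) ∈ S := fun y => by
    have : y ∈ S.map (MonoidHom.snd X Y) := hY ▸ Subgroup.mem_top y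
    simpa using this
  -- The Goursat kernel of `S` in `X`; it is normal because `S` projects onto `X`. Once it is all of
  -- `X`, surjectivity onto `Y` finishes.
  let M := S.comap (MonoidHom.inl X Y)
  have hM : ∀ x, x ∈ M ↔ (x, (1 : Y)) ∈ S := fun x => Iff.rfl
  have hnormal : M.Normal := ⟨fun x hx g => by
    obtain ⟨y, hy⟩ := hX' g
    simpa [hM] using S.mul_mem (S.mul_mem hy ((hM x).1 hx)) (S.inv_mem hy)⟩
  -- The commutator subgroup of `S` projects onto that of `Y`, with first coordinates in that of
  -- `X`.
  have hcomm : ∀ y ∈ commutator Y, ∃ x ∈ commutator X, (x, y) ∈ S := by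
    intro y hy
    rw [commutator_def, ← hY, ← Subgroup.map_commutator] at hy
    obtain ⟨⟨x, y'⟩, hxy, rfl⟩ := hy
    refine ⟨x, ?_, Subgroup.commutator_le_self S hxy⟩
    have : x ∈ (⁅S, S⁆).map (MonoidHom.fst X Y) := ⟨_, hxy, rfl⟩
    rwa [Subgroup.map_commutator, hX] at this
  have htop : M = ⊤ := by
    refine eq_top_of_sup_commutator_eq_top M (eq_top_iff.2 fun x _ => ?_)
    -- An element of `S` congruent to `(x, 1)` is corrected by `(c, b⁻¹)` in `S` with `c` a member
    -- of `commutator X`, which moves it into `M` without changing the class of `x`.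
    obtain ⟨⟨a, b⟩, hab, ha, hb⟩ := h x 1
    obtain ⟨c, hc, hcb⟩ := hcomm _ hb
    have h1 : a * c ∈ M := by
      rw [hM]; simpa using S.mul_mem hab hcb
    have h2 : x = (a * c) * (c⁻¹ * (a⁻¹ * x)) := by group
    rw [h2]
    exact Subgroup.mul_mem_sup h1 ((commutator X).mul_mem ((commutator X).inv_mem hc) ha)
  refine eq_top_iff.2 fun ⟨x, y⟩ _ => ?_
  obtain ⟨a, ha⟩ := hY' y
  have : x * a⁻¹ ∈ M := htop ▸ Subgroup.mem_top _
  simpa using S.mul_mem ((hM _).1 this) ha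

theorem rank_prod_le_add (X Y : Type*) [Group X] [Group Y] [Group.FG X] [Group.FG Y]
    [Group.FG (X × Y)] :
    Group.rank (X × Y) ≤ Group.rank X + Group.rank Y := by
  obtain ⟨s, hs⟩ := exists_closure_range_eq_top_of_rank_le (le_refl (Group.rank X))
  obtain ⟨t, ht⟩ := exists_closure_range_eq_top_of_rank_le (le_refl (Group.rank Y))
  refine rank_le_of_closure_range_eq_top
    (Fin.append (fun i => (s i, 1)) (fun i => (1, t i))) (eq_top_iff.2 fun ⟨x, y⟩ _ => ?_)
  set C := Subgroup.closure (Set.range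
    (Fin.append (fun i => (s i, (1 : Y))) (fun i => ((1 : X), t i))))
  have hx : (⊤ : Subgroup X) ≤ C.comap (MonoidHom.inl X Y) := by
    rw [← hs, Subgroup.closure_le]
    rintro _ ⟨i, rfl⟩
    exact Subgroup.subset_closure ⟨Fin.castAdd _ i, by simp⟩
  have hy : (⊤ : Subgroup Y) ≤ C.comap (MonoidHom.inr X Y) := by
    rw [← ht, Subgroup.closure_le]
    rintro _ ⟨i, rfl⟩
    exact Subgroup.subset_closure ⟨Fin.natAdd _ i, by simp⟩
  simpa using C.mul_mem (hx (Subgroup.mem_top x)) (hy (Subgroup.mem_top y))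

/-- If `X`, `Y` and a quotient `A × B` of `X × Y` with kernel inside the commutator
subgroup are all `d`-generated, then so is `X × Y`, provided `X` is solvable. -/
theorem rank_prod_le {X Y A B : Type*} [Group X] [Group Y] [Group A] [Group B] [Finite X]
    [Finite Y] [Group.FG (A × B)] [Group.IsSolvable X] (φ : X →* A) (ψ : Y →* B)
    (hφ : Function.Surjective φ) (hψ : Function.Surjective ψ) (hφ' : φ.ker ≤ commutator X)
    (hψ' : ψ.ker ≤ commutator Y) {d : ℕ} (hX : Group.rank X ≤ d) (hY : Group.rank Y ≤ d)
    (hAB : Group.rank (A × B) ≤ d) : Group.rank (X × Y) ≤ d := by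
  obtain ⟨t, ht⟩ := exists_closure_range_eq_top_of_rank_le hAB
  have htA : Subgroup.closure (Set.range (MonoidHom.fst A B ∘ t)) = ⊤ := by
    rw [Set.range_comp, ← MonoidHom.map_closure, ht,
      Subgroup.map_top_of_surjective _ Prod.fst_surjective]
  have htB : Subgroup.closure (Set.range (MonoidHom.snd A B ∘ t)) = ⊤ := by
    rw [Set.range_comp, ← MonoidHom.map_closure, ht,
      Subgroup.map_top_of_surjective _ Prod.snd_surjective]
  -- The two factors are lifted independently: each lift generates its own factor, which makes the
  -- paired tuple subdirect, and the pair still covers `A × B`.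
  obtain ⟨u, hu, hu'⟩ := exists_lift_closure_range_eq_top φ hφ hX _ htA
  obtain ⟨v, hv, hv'⟩ := exists_lift_closure_range_eq_top ψ hψ hY _ htB
  refine rank_le_of_closure_range_eq_top (fun i => (u i, v i)) (eq_top_of_subdirect _ ?_ ?_ ?_)
  · rw [MonoidHom.map_closure, ← Set.range_comp]
    exact hu'
  · rw [MonoidHom.map_closure, ← Set.range_comp]
    exact hv'
  · intro x y
    have hmap : (Subgroup.closure (Set.range fun i => (u i, v i))).map (φ.prodMap ψ) = ⊤ := by
      rw [MonoidHom.map_closure, ← Set.range_comp, ← ht]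
      congr 2
      ext i
      · exact congrFun hu i
      · exact congrFun hv i
    have hmem : (φ x, ψ y) ∈
        (Subgroup.closure (Set.range fun i => (u i, v i))).map (φ.prodMap ψ) :=
      hmap ▸ Subgroup.mem_top _
    obtain ⟨⟨a, b⟩, hs, hab⟩ := hmem
    rw [MonoidHom.prodMap_def, Prod.ext_iff] at hab
    have h1 : φ a = φ x := hab.1
    have h2 : ψ b = ψ y := hab.2
    exact ⟨(a, b), hs, hφ' (by simp [MonoidHom.mem_ker, h1]),
      hψ' (by simp [MonoidHom.mem_ker, h2])⟩

/-- The multiplicative equivalence `G ^ (k + 1) ≃ G × G ^ k`. -/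
def piFinSuccMulEquiv (G : Type*) [Group G] (k : ℕ) : (Fin (k + 1) → G) ≃* G × (Fin k → G) where
  toFun g := (g 0, Fin.tail g)
  invFun g := Fin.cons g.1 g.2
  left_inv g := by simp
  right_inv g := by simp
  map_mul' _ _ := rfl

theorem rank_pi_le_mul (G : Type*) [Group G] [Finite G] (k : ℕ) :
    Group.rank (Fin k → G) ≤ k * Group.rank G := by
  induction k with
  | zero => simp [Group.rank_eq_zero]
  | succ k ih =>
    rw [Group.rank_congr (piFinSuccMulEquiv G k), add_mul, one_mul, add_comm]
    exact (rank_prod_le_add _ _).trans (by omega)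

/-- Factors are added one at a time. The crude additive bound is applied only to powers of `G / G'`,
so `rank G` never gets multiplied by `k`. -/
theorem rank_pi_le {G : Type*} [Group G] [Finite G] [Group.IsSolvable G] {d : ℕ}
    (hG : Group.rank G ≤ d) (k : ℕ) (hk : k * Group.rank (G ⧸ commutator G) ≤ d) :
    Group.rank (Fin k → G) ≤ d := by
  induction k with
  | zero => simp [Group.rank_eq_zero]
  | succ k ih =>
    rw [Group.rank_congr (piFinSuccMulEquiv G k)]
    rw [add_mul, one_mul] at hk
    have hcomm : Subgroup.pi Set.univ (fun _ : Fin k => commutator G) = commutator (Fin k → G) := by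
      rw [commutator_def, commutator_def, ← Subgroup.pi_top Set.univ,
        Subgroup.commutator_pi_pi_of_finite]
    let ψ : (Fin k → G) →* (Fin k → G ⧸ commutator G) :=
      MonoidHom.pi fun i => (QuotientGroup.mk' (commutator G)).comp (Pi.evalMonoidHom _ i)
    refine rank_prod_le (QuotientGroup.mk' (commutator G)) ψ
      (QuotientGroup.mk'_surjective _) ?_ (QuotientGroup.ker_mk' _).le ?_ hG (ih (by omega)) ?_
    · intro b
      choose g hg using fun i => QuotientGroup.mk'_surjective (commutator G) (b i)
      exact ⟨g, funext hg⟩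
    · intro g hg
      rw [← hcomm, Subgroup.mem_pi]
      intro i _
      exact (QuotientGroup.eq_one_iff _).1 (congrFun hg i)
    · have := rank_pi_le_mul (G ⧸ commutator G) k
      exact (rank_prod_le_add _ _).trans (by omega)

end Group

/-! ### Word length, diameter and coordinatewise generating sets -/

theorem exists_list_length_eq_wordLength {G : Type*} [Group G] [Finite G] {A : Set G}
    (hA : Subgroup.closure A = ⊤) (g : G) :
    ∃ l : List G, l.length = wordLength A g ∧ (∀ x ∈ l, x ∈ A) ∧ l.prod = g := by
  have hg : g ∈ Submonoid.closure A := by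
    rw [← Subgroup.closure_toSubmonoid_of_finite, hA]; trivial
  obtain ⟨l, hl, hp⟩ := Submonoid.exists_list_of_mem_closure hg
  exact Nat.sInf_mem (s := {k : ℕ | ∃ l : List G, l.length = k ∧ (∀ x ∈ l, x ∈ A) ∧ l.prod = g})
    ⟨_, l, rfl, hl, hp⟩

theorem wordLength_prod_le {G : Type*} [Group G] {A : Set G} {l : List G}
    (hl : ∀ x ∈ l, x ∈ A) : wordLength A l.prod ≤ l.length :=
  Nat.sInf_le ⟨l, rfl, hl, rfl⟩

/-- A prefix of a shortest word is itself shortest: a shorter spelling of it would shorten the whole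
word. -/
theorem exists_wordLength_eq {G : Type*} [Group G] [Finite G] {A : Set G}
    (hA : Subgroup.closure A = ⊤) (g : G) {j : ℕ} (hj : j ≤ wordLength A g) :
    ∃ h : G, wordLength A h = j := by
  obtain ⟨l, hl, hlA, rfl⟩ := exists_list_length_eq_wordLength hA g
  refine ⟨(l.take j).prod, le_antisymm ?_ ?_⟩
  · refine (wordLength_prod_le fun x hx => hlA x (List.mem_of_mem_take hx)).trans ?_
    simp
  · obtain ⟨l', hl', hlA', hp⟩ := exists_list_length_eq_wordLength hA (l.take j).prod
    have h : wordLength A (l' ++ l.drop j).prod ≤ (l' ++ l.drop j).length :=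
      wordLength_prod_le fun x hx => (List.mem_append.1 hx).elim (hlA' x)
        fun hx => hlA x (List.mem_of_mem_drop hx)
    rw [List.prod_append, hp, List.prod_take_mul_prod_drop, List.length_append,
      List.length_drop] at h
    omega

/-- Each length from 2 up to that of `g` is attained, necessarily outside `A ∪ {1}`, a set with `|A|
+ 1` elements. -/
theorem wordLength_le_card_sub_ncard {G : Type*} [Group G] [Finite G] {A : Set G}
    (hA : Subgroup.closure A = ⊤) (h1 : (1 : G) ∉ A) (g : G) :
    wordLength A g ≤ Nat.card G - A.ncard := by
  have hone : wordLength A (1 : G) = 0 :=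
    Nat.le_zero.1 (wordLength_prod_le (A := A) (l := []) (by simp))
  have hmem : ∀ x ∈ A, wordLength A x ≤ 1 := fun x hx => by
    simpa using wordLength_prod_le (A := A) (l := [x]) (by simpa using hx)
  have hsub : (Finset.Icc 2 (wordLength A g) : Set ℕ) ⊆ wordLength A '' (insert 1 A)ᶜ := by
    intro j hj
    rw [Finset.mem_coe, Finset.mem_Icc] at hj
    obtain ⟨h, rfl⟩ := exists_wordLength_eq hA g hj.2
    refine ⟨h, ?_, rfl⟩
    rintro (rfl | hh)
    · omega
    · have := hmem h hh; omega
  have h2 := (Set.ncard_le_ncard hsub (Set.toFinite _)).trans (Set.ncard_image_le (Set.toFinite _))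
  rw [Set.ncard_coe_finset, Nat.card_Icc] at h2
  have h3 := Set.ncard_add_ncard_compl (insert 1 A)
  rw [Set.ncard_insert_of_notMem h1] at h3
  omega

theorem IsMinSizeGeneratingSet.one_notMem {G : Type*} [Group G] [Finite G] {A : Set G}
    (hA : IsMinSizeGeneratingSet G A) : (1 : G) ∉ A := by
  classical
  intro h1
  have := Fintype.ofFinite G
  have hc : Subgroup.closure (A \ {1}) = ⊤ := by
    rw [eq_top_iff, ← hA.1, Subgroup.closure_le]
    intro x hx
    by_cases h : x = 1
    · rw [h]; exact one_mem _
    · exact Subgroup.subset_closure ⟨hx, h⟩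
  have h := Group.rank_le (S := (A \ {1}).toFinset) (by simpa using hc)
  rw [← Set.ncard_eq_toFinset_card', ← hA.2] at h
  have := Set.ncard_sdiff_singleton_lt_of_mem h1 (Set.toFinite A)
  omega

theorem exists_isMinSizeGeneratingSet (G : Type*) [Group G] [Finite G] :
    ∃ A : Set G, IsMinSizeGeneratingSet G A := by
  obtain ⟨S, hS, hc⟩ := Group.rank_spec G
  exact ⟨S, hc, by rw [Set.ncard_coe_finset, hS]⟩

/-- Each coordinate in the support is spelled separately with the copy of `B` there, at cost at most
`D`. -/
theorem exists_list_prod_eq_pi {ι H : Type*} [DecidableEq ι] [Group H] [Finite H] {B : Set H}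
    (hB : Subgroup.closure B = ⊤) {D : ℕ} (hD : ∀ h, wordLength B h ≤ D) (s : Finset ι)
    (g : ι → H) (hg : ∀ i ∉ s, g i = 1) :
    ∃ l : List (ι → H), l.length ≤ s.card * D ∧
      (∀ x ∈ l, x ∈ ⋃ i, MonoidHom.mulSingle (fun _ : ι => H) i '' B) ∧ l.prod = g := by
  induction s using Finset.induction_on generalizing g with
  | empty => exact ⟨[], by simp, by simp, by ext i; simp [hg i]⟩
  | insert a s ha ih =>
    obtain ⟨l, hl, hlA, hp⟩ := ih (Function.update g a 1) (fun i hi => by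
      by_cases h : i = a
      · subst h; simp
      · rw [Function.update_of_ne h]; exact hg i (by simp [h, hi]))
    obtain ⟨l', hl', hlB, hp'⟩ := exists_list_length_eq_wordLength hB (g a)
    refine ⟨l'.map (MonoidHom.mulSingle (fun _ => H) a) ++ l, ?_, ?_, ?_⟩
    · rw [List.length_append, List.length_map, hl', Finset.card_insert_of_notMem ha]
      have := hD (g a)
      rw [add_mul]
      omega
    · intro x hx
      rcases List.mem_append.1 hx with hx | hx
      · obtain ⟨y, hy, rfl⟩ := List.mem_map.1 hx
        exact Set.mem_iUnion.2 ⟨a, y, hlB y hy, rfl⟩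
      · exact hlA x hx
    · rw [List.prod_append, hp, ← map_list_prod, hp']
      ext i
      by_cases h : i = a
      · subst h; simp
      · simp [h]

/-- If `rank (H ^ m) = m * rank H` for all `m`, then `H` satisfies the weak conjecture. -/
theorem satisfiesWeakConjecture_of_mul_rank_le {H : Type*} [Group H] [Finite H]
    (h : ∀ m : ℕ, m * Group.rank H ≤ Group.rank (Fin m → H)) : SatisfiesWeakConjecture H := by
  classical
  intro m
  obtain ⟨B, hB⟩ := exists_isMinSizeGeneratingSet H
  have hD := wordLength_le_card_sub_ncard hB.1 hB.one_notMem
  set A : Set (Fin m → H) := ⋃ i, MonoidHom.mulSingle (fun _ : Fin m => H) i '' B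
  have hlist := fun g : Fin m → H =>
    exists_list_prod_eq_pi hB.1 hD Finset.univ g (by simp)
  have hA : Subgroup.closure A = ⊤ := by
    refine eq_top_iff.2 fun g _ => ?_
    obtain ⟨l, -, hl, rfl⟩ := hlist g
    exact list_prod_mem fun x hx => Subgroup.subset_closure (hl x hx)
  have hle : A.ncard ≤ m * Group.rank H := by
    refine (Set.ncard_iUnion_le_of_fintype _).trans ?_
    calc _ ≤ ∑ _i : Fin m, B.ncard :=
          Finset.sum_le_sum fun i _ => Set.ncard_image_le (Set.toFinite B)
      _ = m * Group.rank H := by simp [hB.2]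
  have hge : Group.rank (Fin m → H) ≤ A.ncard := by
    have := Fintype.ofFinite (Fin m → H)
    rw [Set.ncard_eq_toFinset_card']
    exact Group.rank_le (by simpa using hA)
  -- Additivity of the rank is used exactly here: it makes the union of the copies of `B` a
  -- generating set of minimum size.
  refine ⟨A, ⟨hA, le_antisymm (hle.trans (h m)) hge⟩, ?_⟩
  have hdiam : groupDiam (Fin m → H) A ≤ m * (Nat.card H - B.ncard) := by
    refine csSup_le (Set.range_nonempty _) ?_
    rintro _ ⟨g, rfl⟩
    obtain ⟨l, hl, hlA, rfl⟩ := hlist g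
    exact (wordLength_prod_le hlA).trans (by simpa using hl)
  have hcard : B.ncard ≤ Nat.card H := Set.ncard_le_card B
  rw [← hB.2, ← Nat.cast_sub hcard]
  exact_mod_cast hdiam

/-! ### Lower bound for the rank via elementary abelian quotients -/

/-- Finitely many prescribed reductions modulo distinct primes can be realised at once. -/
theorem exists_natCast_eq_ite (s : Finset ℕ) (hs : ∀ p ∈ s, p.Prime) (p : ℕ) :
    ∃ c : ℕ, ∀ q ∈ s, c ≡ (if q = p then 1 else 0) [MOD q] :=
  let c := Nat.chineseRemainderOfFinset (fun q => if q = p then 1 else 0) id s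
    (fun q hq => (hs q hq).ne_zero)
    (fun q hq r hr h => (Nat.coprime_primes (hs q hq) (hs r hr)).2 h)
  ⟨c.1, c.2⟩

theorem exists_span_range_eq_top_of_finrank_le {K V : Type*} [Field K] [AddCommGroup V] [Module K V]
    [Module.Finite K V] {d : ℕ} (h : Module.finrank K V ≤ d) :
    ∃ v : Fin d → V, Submodule.span K (Set.range v) = ⊤ := by
  let b := Module.finBasis K V
  refine ⟨fun i => if hi : (i : ℕ) < Module.finrank K V then b ⟨i, hi⟩ else 0, ?_⟩
  rw [eq_top_iff, ← b.span_eq, Submodule.span_le]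
  rintro _ ⟨i, rfl⟩
  exact Submodule.subset_span ⟨⟨i, i.2.trans_le h⟩, by simp⟩

/-- In a finite abelian group, a family generating modulo every prime generates. -/
theorem AddSubgroup.eq_top_of_forall_prime {A : Type*} [AddCommGroup A] [Finite A]
    (S : AddSubgroup A)
    (h : ∀ p : ℕ, p.Prime → p ∣ Nat.card A → ∀ x : A, ∃ s ∈ S, ∃ y, x = s + p • y) : S = ⊤ := by
  by_contra hS
  have hcard : Nat.card (A ⧸ S) ≠ 1 := by
    rwa [← AddSubgroup.index_eq_card, Ne, AddSubgroup.index_eq_one]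
  obtain ⟨p, hp, hdvd⟩ := Nat.exists_prime_and_dvd hcard
  have : Fact p.Prime := ⟨hp⟩
  -- Multiplication by `p` is onto the finite group `A ⧸ S`, hence injective, which contradicts
  -- Cauchy's theorem.
  have hsurj : Function.Surjective (fun x : A ⧸ S => p • x) := by
    intro x
    induction x using QuotientAddGroup.induction_on with
    | H x =>
      obtain ⟨s, hs, y, rfl⟩ := h p hp (hdvd.trans (AddSubgroup.card_quotient_dvd_card S)) x
      refine ⟨(y : A ⧸ S), ?_⟩
      rw [QuotientAddGroup.mk_add, (QuotientAddGroup.eq_zero_iff s).2 hs, zero_add]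
      rfl
  have hinj := Finite.injective_iff_surjective.2 hsurj
  obtain ⟨x, hx⟩ := exists_prime_addOrderOf_dvd_card' p hdvd
  have hx0 : x = 0 := hinj (by simp [← hx, addOrderOf_nsmul_eq_zero])
  rw [hx0, addOrderOf_zero] at hx
  exact hp.one_lt.ne hx

/-- A finite abelian group maps onto an elementary abelian `p`-group of the same rank. -/
theorem AddGroup.exists_surjective_pi_zmod (A : Type*) [AddCommGroup A] [Finite A] :
    ∃ p : ℕ, p.Prime ∧ ∃ f : A →+ (Fin (AddGroup.rank A) → ZMod p), Function.Surjective f := by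
  classical
  by_contra! hcon
  -- If `A / pA` had dimension at least `rank A`, projecting to that many coordinates would give the
  -- desired surjection.
  have hfin : ∀ p : ℕ, p.Prime → Module.finrank (ZMod p) (ModN A p) < AddGroup.rank A := by
    intro p hp
    have : Fact p.Prime := ⟨hp⟩
    by_contra! hle
    have : Module.Finite (ZMod p) (ModN A p) :=
      have : Finite (ModN A p) := Finite.of_surjective _ (Submodule.mkQ_surjective _)
      Module.Finite.of_finite
    obtain ⟨g, hg⟩ : ∃ g : ModN A p →ₗ[ZMod p] (Fin (AddGroup.rank A) → ZMod p),
        Function.Surjective g := by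
      let b := Module.finBasis (ZMod p) (ModN A p)
      refine ⟨(LinearMap.funLeft (ZMod p) (ZMod p) (Fin.castLE hle)).comp
        b.equivFun.toLinearMap, ?_⟩
      exact (LinearMap.funLeft_surjective_of_injective (ZMod p) (ZMod p) _ (Fin.castLE_injective hle)).comp
        b.equivFun.surjective
    exact hcon p hp (g.toAddMonoidHom.comp (ModN.mkQ p))
      (hg.comp (Submodule.mkQ_surjective _))
  -- The aim is to generate `A` by `d = rank A - 1` elements. The prime 2 serves only to show that
  -- the rank is positive.
  obtain ⟨d, hd⟩ : ∃ d, AddGroup.rank A = d + 1 :=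
    Nat.exists_eq_add_one.2 ((Nat.zero_le _).trans_lt (hfin 2 Nat.prime_two))
  have hgen : ∀ p : ℕ, p.Prime → ∃ t : Fin d → A, ∀ x : A,
      ∃ s ∈ AddSubgroup.closure (Set.range (ModN.mkQ p ∘ t)), ModN.mkQ p x = s := by
    intro p hp
    have : Fact p.Prime := ⟨hp⟩
    have : Finite (ModN A p) := Finite.of_surjective _ (Submodule.mkQ_surjective _)
    have : Module.Finite (ZMod p) (ModN A p) := Module.Finite.of_finite
    obtain ⟨v, hv⟩ := exists_span_range_eq_top_of_finrank_le (K := ZMod p) (V := ModN A p) (d := d)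
      (by have := hfin p hp; omega)
    choose t ht using fun i => Submodule.mkQ_surjective _ (v i)
    have htv : ModN.mkQ p ∘ t = v := funext ht
    refine ⟨t, fun x => ⟨_, ?_, rfl⟩⟩
    rw [htv]
    have : Submodule.span (ZMod p) (Set.range v) ≤
        AddSubgroup.toZModSubmodule p (AddSubgroup.closure (Set.range v)) :=
      Submodule.span_le.2 AddSubgroup.subset_closure
    exact this (hv ▸ Submodule.mem_top)
  choose! t ht using hgen
  set P := (Nat.card A).primeFactors
  choose c hc using exists_natCast_eq_ite P (fun p hp => Nat.prime_of_mem_primeFactors hp)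
  -- The coefficient `c p` is 1 modulo `p` and 0 modulo the other prime divisors of `|A|`, so `u`
  -- agrees with `t q` modulo each such prime `q`.
  let u : Fin d → A := fun i => ∑ p ∈ P, c p • t p i
  have hu : ∀ q ∈ P, ModN.mkQ q ∘ u = ModN.mkQ q ∘ t q := by
    intro q hq
    ext i
    have hred : ∀ p, ModN.mkQ q (c p • t p i) = if q = p then ModN.mkQ q (t p i) else 0 := by
      intro p
      have h := (ZMod.natCast_eq_natCast_iff _ _ _).2 (hc p q hq)
      rw [map_nsmul, ← Nat.cast_smul_eq_nsmul (ZMod q), h]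
      split_ifs <;> simp
    simp only [Function.comp_apply, u, map_sum, hred]
    simp [hq]
  have htop : AddSubgroup.closure (Set.range u) = ⊤ := by
    refine AddSubgroup.eq_top_of_forall_prime _ fun q hq hdvd x => ?_
    have hqP : q ∈ P := Nat.mem_primeFactors.2 ⟨hq, hdvd, Nat.card_pos.ne'⟩
    obtain ⟨s, hs, hxs⟩ := ht q hq x
    rw [← hu q hqP, Set.range_comp] at hs
    have hs' : s ∈ (AddSubgroup.closure (Set.range u)).map (ModN.mkQ q) := by
      rw [AddMonoidHom.map_closure]; exact hs
    obtain ⟨z, hz, rfl⟩ := hs'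
    obtain ⟨y, hy⟩ : x - z ∈ LinearMap.range (LinearMap.lsmul ℤ A q) :=
      (Submodule.Quotient.eq _).1 hxs
    refine ⟨z, hz, y, ?_⟩
    have : (q : ℤ) • y = x - z := hy
    rw [← natCast_zsmul, this]
    abel
  have := AddGroup.rank_le (S := Finset.univ.image u) (by simpa using htop)
  have h2 := this.trans (Finset.card_image_le)
  simp at h2
  omega

/-- Elements that generate `V` as a group also span it over `ZMod p`. -/
theorem Group.finrank_le_rank_multiplicative {p : ℕ} [Fact p.Prime] (V : Type*) [AddCommGroup V]
    [Module (ZMod p) V] [Finite V] :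
    Module.finrank (ZMod p) V ≤ Group.rank (Multiplicative V) := by
  classical
  obtain ⟨S, hS, hc⟩ := Group.rank_spec (Multiplicative V)
  set T : Finset V := S.image Multiplicative.toAdd
  have htop : Submodule.span (ZMod p) (T : Set V) = ⊤ := by
    refine eq_top_iff.2 fun x _ => ?_
    have hle : Subgroup.closure (S : Set (Multiplicative V)) ≤
        AddSubgroup.toSubgroup
          (Submodule.span (ZMod p) (T : Set V) : Submodule (ZMod p) V).toAddSubgroup := by
      rw [Subgroup.closure_le]
      exact fun y hy => Submodule.subset_span (R := ZMod p) (M := V)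
        (Finset.mem_coe.2 (Finset.mem_image_of_mem _ (Finset.mem_coe.1 hy)))
    exact hle (hc ▸ Subgroup.mem_top (Multiplicative.ofAdd x))
  have := finrank_span_finset_le_card (R := ZMod p) T
  rw [Set.finrank, htop, finrank_top] at this
  exact this.trans (Finset.card_image_le.trans hS.le)

theorem Group.rank_le_rank_additive (G : Type*) [Group G] [Finite G] :
    Group.rank G ≤ AddGroup.rank (Additive G) := by
  classical
  obtain ⟨S, hS, hc⟩ := AddGroup.rank_spec (Additive G)
  refine (Group.rank_le (S := S.image Additive.toMul) (eq_top_iff.2 fun x _ => ?_)).trans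
    (Finset.card_image_le.trans hS.le)
  have hle : AddSubgroup.closure (S : Set (Additive G)) ≤
      (Subgroup.closure ((S.image Additive.toMul : Finset G) : Set G)).toAddSubgroup :=
    (AddSubgroup.closure_le _).2 fun y hy => Subgroup.subset_closure (G := G)
      (Finset.mem_coe.2 (Finset.mem_image_of_mem _ (Finset.mem_coe.1 hy)))
  exact hle (hc ▸ AddSubgroup.mem_top (Additive.ofMul x))

/-- A single prime `p` serves all `k` coordinates, so `G ^ k` maps onto a vector space over `ZMod p`
of dimension `k` times the rank of the abelianization. -/
theorem Group.mul_rank_abelianization_le_rank_pi (G : Type*) [Group G] [Finite G] (k : ℕ) :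
    k * Group.rank (G ⧸ commutator G) ≤ Group.rank (Fin k → G) := by
  obtain ⟨p, hp, f, hf⟩ := AddGroup.exists_surjective_pi_zmod (Additive (Abelianization G))
  have : Fact p.Prime := ⟨hp⟩
  have hrank : Group.rank (G ⧸ commutator G) ≤ AddGroup.rank (Additive (Abelianization G)) :=
    Group.rank_le_rank_additive (Abelianization G)
  let V := Fin k → Fin (AddGroup.rank (Additive (Abelianization G))) → ZMod p
  let F : (Fin k → G) →* Multiplicative V :=
    { toFun := fun g => Multiplicative.ofAdd fun i =>
        f (Additive.ofMul (Abelianization.of (g i)))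
      map_one' := congrArg Multiplicative.ofAdd (by ext; simp; rfl)
      map_mul' := fun a b => congrArg Multiplicative.ofAdd (by ext; simp; rfl) }
  have hF : Function.Surjective F := by
    intro v
    choose g hg using fun i => hf (v.toAdd i)
    choose h hh using fun i => QuotientGroup.mk_surjective (s := commutator G) (g i).toMul
    refine ⟨h, funext fun i => (hg i ▸ congrArg (fun x => f (Additive.ofMul x)) (hh i) :)⟩
  have h1 := Group.finrank_le_rank_multiplicative (p := p) V
  have h2 := Group.rank_le_of_surjective F hF
  have h3 : Module.finrank (ZMod p) V =
      k * AddGroup.rank (Additive (Abelianization G)) := by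
    simp [V, Module.finrank_pi_fintype]
  exact (Nat.mul_le_mul_left k hrank).trans (h3 ▸ h1.trans h2)

/-! ### Conclusion -/

theorem mainTheorem3 (G : Type*) [Group G] [Finite G] [Group.IsSolvable G] (n : ℕ)
    (hn : (Group.rank G : ℚ) / (Group.rank (G ⧸ commutator G) : ℚ) ≤ (n : ℚ)) :
    SatisfiesWeakConjecture (Fin n → G) := by
  have hle : Group.rank G ≤ n * Group.rank (G ⧸ commutator G) := by
    -- Clearing the denominator needs it to be positive; for nontrivial `G` this holds because a
    -- solvable group is not perfect.
    rcases subsingleton_or_nontrivial G with h | h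
    · simp [Group.rank_eq_zero]
    · have : Nontrivial (G ⧸ commutator G) := by
        rw [← not_subsingleton_iff_nontrivial]
        exact fun hs => (Group.IsSolvable.commutator_lt_top_of_nontrivial G).ne
          (QuotientGroup.subgroup_eq_top_of_subsingleton _ hs)
      rw [div_le_iff₀ (by exact_mod_cast Group.rank_pos (G ⧸ commutator G))] at hn
      exact_mod_cast hn
  refine satisfiesWeakConjecture_of_mul_rank_le fun m => ?_
  let e : (Fin m → Fin n → G) ≃* (Fin (m * n) → G) :=
    { toFun := fun g i => g (finProdFinEquiv.symm i).1 (finProdFinEquiv.symm i).2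
      invFun := fun g i j => g (finProdFinEquiv (i, j))
      left_inv := fun g => by simp
      right_inv := fun g => by ext i; exact congrArg g (finProdFinEquiv.apply_symm_apply i)
      map_mul' := fun _ _ => rfl }
  -- The upper bound is used for `G ^ n` with `d = n * β`, the lower bound for `G ^ (m * n)`.
  calc m * Group.rank (Fin n → G)
      ≤ m * (n * Group.rank (G ⧸ commutator G)) :=
        Nat.mul_le_mul_left m (Group.rank_pi_le hle n le_rfl)
    _ = m * n * Group.rank (G ⧸ commutator G) := (mul_assoc _ _ _).symm
    _ ≤ Group.rank (Fin (m * n) → G) := Group.mul_rank_abelianization_le_rank_pi G (m * n)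
    _ = Group.rank (Fin m → Fin n → G) := (Group.rank_congr e).symm
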